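/- For real $t\ge 0$ let $$\Psi(t)=4(e^{t/2}+e^{-t/2}-2)-\sum_{1\le n\le e^{t}}\frac{\Lambda(n)}{\sqrt n}(t-\log n)+\frac t2\Bigl[\frac{\Gamma'}{\Gamma}\Bigl(\frac14\Bigr)-\log\pi\Bigr]+\frac14\Bigl(C-e^{-t/2}\,\Phi(e^{-2t},2,\tfrac14)\Bigr),$$ where $\Lambda$ is the von Mangoldt function, $C=\pi^2+8\sum_{n\ge0}(-1)^n(2n+1)^{-2}$ and $\Phi(z,s,b)=\sum_{n\ge0}(n+b)^{-s}z^n$ is the Hurwitz–Lerch zeta function. Extend $\Psi$ to an even function on $\mathbb R$, and put $g(t)=-\Psi(t)$. For a function $h$ write $G_h(t,u)=h(t-u)-h(t)-h(-u)+h(0)$. For $0<a<\infty$ let $\mathcal G_a$ be the class of continuous functions $h:(-2a,2a)\to\mathbb C$ such that $h(-t)=\overline{h(t)}$ for all $t\in(-2a,2a)$ and $$\sum_{i,j=1}^{n}G_h(t_i,t_j)\,\xi_i\overline{\xi_j}\ge 0$$ for all $n\in\mathbb N$, all $\xi_1,\dots,\xi_n\in\mathbb C$ and all $t_1,\dots,t_n\in(-a,a)$.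 **Theorem 4.2.** There exists $a_0>0$ such that, for every $0<a<a_0$, the kernel $G_g$ is positive definite on $L^2(-a,a)$; that is, the integral $$\langle\phi_1,\phi_2\rangle_{G_g,a}=\int_{-a}^{a}\int_{-a}^{a}G_g(t,u)\,\phi_1(u)\,\overline{\phi_2(t)}\,du\,dt$$ converges absolutely for all $\phi_1,\phi_2\in L^2(-a,a)$, and $\langle\phi,\phi\rangle_{G_g,a}>0$ for every non-zero $\phi\in L^2(-a,a)$. In particular, for every $0<a<a_0$ the restriction of $g$ to $(-2a,2a)$ belongs to $\mathcal G_a$. -/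

import Mathlib

open MeasureTheory Set
open scoped ComplexOrder ComplexConjugate

noncomputable section

/-- The Hurwitz–Lerch zeta function `Φ(z, s, a) = ∑_{n ≥ 0} (n + a)^(-s) z^n`, at real arguments. -/
def hurwitzLerch (z s a : ℝ) : ℝ := ∑' n : ℕ, ((n : ℝ) + a) ^ (-s) * z ^ n

/-- Catalan's constant `G = ∑_{n ≥ 0} (-1)^n (2n + 1)^(-2)`. -/
def catalanConst : ℝ := ∑' n : ℕ, (-1 : ℝ) ^ n / (2 * (n : ℝ) + 1) ^ 2

/-- The explicit expression for `Ψ(t)`, for `t ≥ 0`.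
Here `logDeriv Real.Gamma (1 / 4)` is `Γ'(1/4) / Γ(1/4)`. -/
def psiFormula (t : ℝ) : ℝ :=
  4 * (Real.exp (t / 2) + Real.exp (-t / 2) - 2)
    - ∑ n ∈ Finset.Icc 1 ⌊Real.exp t⌋₊,
        ArithmeticFunction.vonMangoldt n / Real.sqrt n * (t - Real.log n)
    + t / 2 * (logDeriv Real.Gamma (1 / 4) - Real.log Real.pi)
    + 1 / 4 * ((Real.pi ^ 2 + 8 * catalanConst)
        - Real.exp (-t / 2) * hurwitzLerch (Real.exp (-2 * t)) 2 (1 / 4))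

/-- The function `Ψ`, extended from `[0, ∞)` to an even function on the real line. -/
def Psi (t : ℝ) : ℝ := psiFormula |t|

/-- The screw function of the Riemann zeta-function, `g(t) = -Ψ(t)`. -/
def zetaScrew (t : ℝ) : ℂ := ((-Psi t : ℝ) : ℂ)

/-- The kernel `G_g(t, u) = g(t - u) - g(t) - g(-u) + g(0)`. -/
def screwKernel (g : ℝ → ℂ) (t u : ℝ) : ℂ := g (t - u) - g t - g (-u) + g 0

/-- Kreĭn's class `𝒢_a` (for real `a`): the functions that are continuous and hermitian on
`(-2a, 2a)` and whose kernel is non-negative definite on `(-a, a)`. Each condition involves only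
the values of `g` on `(-2a, 2a)`, so membership of `g : ℝ → ℂ` is a property of its restriction.
In the order of `ℂ`, `0 ≤ z` says that `z` is real and non-negative. -/
def KreinClass (a : ℝ) : Set (ℝ → ℂ) :=
  {g | ContinuousOn g (Ioo (-(2 * a)) (2 * a)) ∧
    (∀ t ∈ Ioo (-(2 * a)) (2 * a), g (-t) = conj (g t)) ∧
    ∀ (n : ℕ) (t : Fin n → ℝ) (ξ : Fin n → ℂ), (∀ i, |t i| < a) →
      0 ≤ ∑ i, ∑ j, screwKernel g (t i) (t j) * ξ i * conj (ξ j)}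

/-- Lebesgue measure on the interval `(-a, a)`. -/
abbrev intervalMeasure (a : ℝ) : Measure ℝ := volume.restrict (Ioo (-a) a)

/-- The form `⟨φ₁, φ₂⟩_{G, a} = ∫_{-a}^{a} ∫_{-a}^{a} G(t, u) φ₁(u) conj(φ₂(t)) du dt`. -/
def kernelForm (G : ℝ → ℝ → ℂ) (a : ℝ) (φ₁ φ₂ : ℝ → ℂ) : ℂ :=
  ∫ t, ∫ u, G t u * φ₁ u * conj (φ₂ t) ∂(intervalMeasure a) ∂(intervalMeasure a)

/-- Absolute convergence of the double integral that defines `kernelForm G a φ₁ φ₂`. -/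
def KernelFormConverges (G : ℝ → ℝ → ℂ) (a : ℝ) (φ₁ φ₂ : ℝ → ℂ) : Prop :=
  Integrable (fun p : ℝ × ℝ => G p.1 p.2 * φ₁ p.2 * conj (φ₂ p.1))
    ((intervalMeasure a).prod (intervalMeasure a))

/-- The kernel `G` is positive definite on `L²(-a, a)`: its form is defined there by absolutely
convergent integrals, and `⟨φ, φ⟩_{G, a}` is real and `> 0` for every non-zero `φ`. -/
def IsPosDefOnL2 (G : ℝ → ℝ → ℂ) (a : ℝ) : Prop :=
  (∀ φ₁ φ₂ : Lp ℂ 2 (intervalMeasure a), KernelFormConverges G a φ₁ φ₂) ∧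
    ∀ φ : Lp ℂ 2 (intervalMeasure a), φ ≠ 0 → 0 < kernelForm G a φ φ

end

/-! For |t| < log 2 the sum over n in Ψ has only the term n = 1, and Λ(1) = 0. So near 0 the
function g is a constant, plus q|t|, minus 4(e^{|t|/2} + e^{-|t|/2}), plus a quarter of the series
`lerchTerm`, whose slope at 0+ is -∞. This singularity outweighs any finite slope, so g + |t| is
still decreasing and convex in |t| near 0. A local Pólya criterion
(`posDefKernel_screwKernel_of_convex`, `exists_posDefKernel_lerch`) then makes its kernel
non-negative definite.

Writing g = (g + |t|) - |t| leaves the kernel of -|t|, twice the covariance of two-sided Brownian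
motion. Its form is twice a squared L²-norm, which vanishes only at φ = 0
(`kernelForm_neg_abs_pos`). The first summand gives a non-negative integral form by approximation
with finite sums (`PosDefKernel.kernelForm_nonneg`), the second gives strictness, and the finite
forms give membership in Kreĭn's class. -/

/-! ### Positive definite kernels: finite quadratic forms -/

/-- A kernel is positive definite on `S` if all its quadratic forms at finite families of points
of `S` are non-negative. -/
def PosDefKernel (S : Set ℝ) (K : ℝ → ℝ → ℂ) : Prop :=
  ∀ (ι : Type) [Fintype ι] (t : ι → ℝ) (ξ : ι → ℂ), (∀ i, t i ∈ S) →
    0 ≤ ∑ i, ∑ j, K (t i) (t j) * ξ i * conj (ξ j)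

namespace PosDefKernel

variable {S : Set ℝ} {K K' : ℝ → ℝ → ℂ}

theorem congr (hK : PosDefKernel S K) (h : ∀ x ∈ S, ∀ y ∈ S, K' x y = K x y) :
    PosDefKernel S K' := by
  intro ι _ t ξ ht
  have := hK ι t ξ ht
  simpa only [h _ (ht _) _ (ht _)] using this

theorem add (hK : PosDefKernel S K) (hK' : PosDefKernel S K') :
    PosDefKernel S fun x y => K x y + K' x y := by
  intro ι _ t ξ ht
  simpa only [add_mul, Finset.sum_add_distrib] using add_nonneg (hK ι t ξ ht) (hK' ι t ξ ht)

theorem const_mul (hK : PosDefKernel S K) {c : ℝ} (hc : 0 ≤ c) :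
    PosDefKernel S fun x y => c * K x y := by
  intro ι _ t ξ ht
  have hc' : (0 : ℂ) ≤ c := by exact_mod_cast hc
  simpa only [mul_assoc, Finset.mul_sum] using mul_nonneg hc' (hK ι t ξ ht)

theorem of_tendsto {F : ℕ → ℝ → ℝ → ℂ} (hF : ∀ᶠ n in Filter.atTop, PosDefKernel S (F n))
    (h : ∀ x y, Filter.Tendsto (fun n => F n x y) Filter.atTop (nhds (K x y))) :
    PosDefKernel S K := by
  intro ι _ t ξ ht
  refine ge_of_tendsto (tendsto_finsetSum _ fun i _ => tendsto_finsetSum _ fun j _ =>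
    ((h (t i) (t j)).mul_const _).mul_const _) ?_
  filter_upwards [hF] with n hn using hn ι t ξ ht

theorem rank_one (S : Set ℝ) (f : ℝ → ℝ) :
    PosDefKernel S fun x y => ((f x * f y : ℝ) : ℂ) := by
  intro ι _ t ξ _
  have : ∑ i, ∑ j, ((f (t i) * f (t j) : ℝ) : ℂ) * ξ i * conj (ξ j)
      = (∑ i, f (t i) * ξ i) * conj (∑ i, f (t i) * ξ i) := by
    rw [map_sum, Finset.sum_mul_sum]
    refine Finset.sum_congr rfl fun i _ => Finset.sum_congr rfl fun j _ => ?_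
    rw [map_mul, Complex.conj_ofReal]
    push_cast
    ring
  rw [this, Complex.mul_conj]
  exact_mod_cast Complex.normSq_nonneg _

theorem integral {α : Type*} [MeasurableSpace α] {μ : Measure α} {F : α → ℝ → ℝ → ℂ}
    (hF : ∀ᵐ s ∂μ, PosDefKernel S (F s)) (hint : ∀ x y, Integrable (fun s => F s x y) μ) :
    PosDefKernel S fun x y => ∫ s, F s x y ∂μ := by
  intro ι _ t ξ ht
  have : ∑ i, ∑ j, (∫ s, F s (t i) (t j) ∂μ) * ξ i * conj (ξ j)
      = ∫ s, ∑ i, ∑ j, F s (t i) (t j) * ξ i * conj (ξ j) ∂μ := by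
    have hI : ∀ i j, Integrable (fun s => F s (t i) (t j) * ξ i * conj (ξ j)) μ :=
      fun i j => ((hint _ _).mul_const _).mul_const _
    rw [integral_finsetSum _ fun i _ => integrable_finsetSum _ fun j _ => hI i j]
    refine Finset.sum_congr rfl fun i _ => ?_
    rw [integral_finsetSum _ fun j _ => hI i j]
    refine Finset.sum_congr rfl fun j _ => ?_
    rw [integral_mul_const, integral_mul_const]
  rw [this]
  exact integral_nonneg_of_ae (by filter_upwards [hF] with s hs using hs ι t ξ ht)

/-- The kernel `G_h` of a positive definite function `h` is positive definite. -/
theorem screwKernel {h : ℝ → ℂ} (hh : PosDefKernel univ fun x y => h (x - y)) (S : Set ℝ) :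
    PosDefKernel S (screwKernel h) := by
  intro ι _ t ξ _
  -- Adjoin the point 0 with weight -∑ ξ i. The total weight is then zero, and expanding the form of
  -- h(x - y) yields the four terms of the screw kernel.
  have := hh (Option ι) (fun o => o.elim 0 t) (fun o => o.elim (-∑ i, ξ i) ξ) fun _ => mem_univ _
  convert this using 1
  simp only [Fintype.sum_option, Option.elim, sub_zero, zero_sub, _root_.screwKernel, map_neg,
    map_sum, sub_mul, add_mul, Finset.sum_add_distrib, Finset.sum_sub_distrib,
    Finset.sum_neg_distrib, mul_neg, neg_mul, ← Finset.mul_sum, ← Finset.sum_mul]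
  have h1 : ∑ i, ∑ j, h (-t j) * ξ i * conj (ξ j) = ∑ j, h (-t j) * (∑ i, ξ i) * conj (ξ j) := by
    rw [Finset.sum_comm]
    simp only [← Finset.mul_sum, ← Finset.sum_mul]
  simp only [h1]
  ring

end PosDefKernel

/-! ### Triangle functions and Pólya's criterion -/

theorem integral_indicator_Ioc_mul (s x y : ℝ) :
    ∫ z, (Ioc x (x + s)).indicator 1 z * (Ioc y (y + s)).indicator (1 : ℝ → ℝ) z
      = max (s - |x - y|) 0 := by
  have : (fun z => (Ioc x (x + s)).indicator 1 z * (Ioc y (y + s)).indicator (1 : ℝ → ℝ) z)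
      = (Ioc x (x + s) ∩ Ioc y (y + s)).indicator 1 := by
    ext z
    rw [inter_indicator_one, Pi.mul_apply]
  rw [this, Ioc_inter_Ioc, integral_indicator_one measurableSet_Ioc, Real.volume_real_Ioc]
  congr 1
  rcases le_total x y with h | h
  · rw [sup_eq_right.2 h, inf_eq_left.2 (by linarith), abs_of_nonpos (by linarith)]
    ring
  · rw [sup_eq_left.2 h, inf_eq_right.2 (by linarith), abs_of_nonneg (by linarith)]
    ring

/-- The triangle is the length of the overlap of (x, x + s] and (y, y + s], hence an integral over z
of rank-one kernels. -/
theorem posDefKernel_triangle (s : ℝ) (S : Set ℝ) :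
    PosDefKernel S fun x y => ((max (s - |x - y|) 0 : ℝ) : ℂ) := by
  have hi : ∀ x y, Integrable (fun z : ℝ =>
      (Ioc x (x + s)).indicator 1 z * (Ioc y (y + s)).indicator (1 : ℝ → ℝ) z) := by
    intro x y
    have h1 : Integrable ((Ioc x (x + s) ∩ Ioc y (y + s)).indicator (1 : ℝ → ℝ)) :=
      (integrable_indicator_iff (measurableSet_Ioc.inter measurableSet_Ioc)).2
        (integrableOn_const (by
          rw [Ioc_inter_Ioc]
          exact measure_Ioc_lt_top.ne))
    rwa [inter_indicator_one] at h1
  refine (PosDefKernel.integral (μ := volume) (F := fun z x y =>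
    (((Ioc x (x + s)).indicator 1 z * (Ioc y (y + s)).indicator (1 : ℝ → ℝ) z : ℝ) : ℂ))
    (Filter.Eventually.of_forall fun z =>
      PosDefKernel.rank_one S fun x => (Ioc x (x + s)).indicator 1 z)
    fun x y => (hi x y).ofReal).congr fun x _ y _ => ?_
  rw [integral_complex_ofReal, integral_indicator_Ioc_mul]

/-- Taylor's formula at `L`, the remainder being written as a mixture of the functions
`t ↦ max (s - t) 0`. -/
theorem eq_add_integral_max {h h' h'' : ℝ → ℝ} (hd : ∀ t, HasDerivAt h (h' t) t)
    (hd' : ∀ t, HasDerivAt h' (h'' t) t) (hc : Continuous h'') {t L : ℝ} (ht : 0 ≤ t)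
    (htL : t ≤ L) :
    h t = h L + (-h' L * max (L - t) 0 + ∫ s in (0 : ℝ)..L, h'' s * max (s - t) 0) := by
  have hc' : Continuous h' := continuous_iff_continuousAt.2 fun x => (hd' x).continuousAt
  have hci : Continuous fun s => h'' s * max (s - t) 0 := by fun_prop
  have h1 : ∫ s in (0 : ℝ)..t, h'' s * max (s - t) 0 = 0 := by
    rw [intervalIntegral.integral_congr (g := fun _ => (0 : ℝ)), intervalIntegral.integral_zero]
    intro s hs
    rw [uIcc_of_le ht] at hs
    simp [hs.2]
  have h2 : ∫ s in t..L, h'' s * max (s - t) 0 = ∫ s in t..L, (s - t) * h'' s := by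
    refine intervalIntegral.integral_congr fun s hs => ?_
    rw [uIcc_of_le htL] at hs
    simp [hs.1, mul_comm]
  have h3 : ∫ s in t..L, (s - t) * h'' s = (L - t) * h' L - (t - t) * h' t - ∫ s in t..L, 1 * h' s :=
    intervalIntegral.integral_mul_deriv_eq_deriv_mul
      (fun s _ => (hasDerivAt_id s).sub_const t) (fun s _ => hd' s)
      (continuous_const.intervalIntegrable _ _) (hc.intervalIntegrable _ _)
  have h4 : ∫ s in t..L, 1 * h' s = h L - h t := by
    simp only [one_mul]
    exact intervalIntegral.integral_eq_sub_of_hasDerivAt (fun s _ => hd s)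
      (hc'.intervalIntegrable _ _)
  rw [← intervalIntegral.integral_add_adjacent_intervals (hci.intervalIntegrable 0 t)
    (hci.intervalIntegrable t L), h1, h2, h3, h4, max_eq_left (by linarith)]
  ring

/-- A local form of Pólya's criterion. -/
theorem posDefKernel_screwKernel_of_convex {h h' h'' : ℝ → ℝ} (hd : ∀ t, HasDerivAt h (h' t) t)
    (hd' : ∀ t, HasDerivAt h' (h'' t) t) (hc : Continuous h'') {a L : ℝ} (ha : 2 * a ≤ L)
    (hL : 0 ≤ L) (hneg : h' L ≤ 0) (hpos : ∀ t ∈ Icc 0 L, 0 ≤ h'' t) :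
    PosDefKernel (Ioo (-a) a) (screwKernel fun t => (h |t| : ℂ)) := by
  have hp : PosDefKernel univ fun x y => ((-h' L * max (L - |x - y|) 0 +
      ∫ s in (0 : ℝ)..L, h'' s * max (s - |x - y|) 0 : ℝ) : ℂ) := by
    have h1 := (posDefKernel_triangle L univ).const_mul (neg_nonneg.2 hneg)
    have h2 := PosDefKernel.integral (μ := volume.restrict (Ioc 0 L)) (S := univ)
      (F := fun s x y => ((h'' s : ℝ) : ℂ) * ((max (s - |x - y|) 0 : ℝ) : ℂ)) (by
        filter_upwards [ae_restrict_mem measurableSet_Ioc] with s hs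
        exact (posDefKernel_triangle s univ).const_mul (hpos s ⟨hs.1.le, hs.2⟩))
      (fun x y => by
        refine Continuous.integrableOn_Ioc ?_
        fun_prop)
    refine (h1.add h2).congr fun x _ y _ => ?_
    rw [intervalIntegral.integral_of_le hL]
    push_cast
    congr 1
    rw [← integral_complex_ofReal]
    push_cast
    rfl
  refine (PosDefKernel.screwKernel (h := fun t => ((-h' L * max (L - |t|) 0 +
      ∫ s in (0 : ℝ)..L, h'' s * max (s - |t|) 0 : ℝ) : ℂ)) hp _).congr fun x hx y hy => ?_
  -- On [-L, L] the function differs from a mixture of triangles by the constant h(L), which cancels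
  -- in the screw kernel. All arguments, x - y included, lie there because 2a ≤ L.
  have key : ∀ t, |t| ≤ L → h |t| = h L + (-h' L * max (L - |t|) 0 +
      ∫ s in (0 : ℝ)..L, h'' s * max (s - |t|) 0) :=
    fun t ht => eq_add_integral_max hd hd' hc (abs_nonneg t) ht
  obtain ⟨hx1, hx2⟩ := hx
  obtain ⟨hy1, hy2⟩ := hy
  simp only [screwKernel]
  rw [key (x - y) (abs_le.2 ⟨by linarith, by linarith⟩), key x (abs_le.2 ⟨by linarith, by linarith⟩),
    key (-y) (abs_le.2 ⟨by linarith, by linarith⟩), key 0 (by simpa using hL)]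
  push_cast
  ring

/-! ### From finite sums to double integrals -/

theorem kernelFormConverges_of_bounded {K : ℝ → ℝ → ℂ} {a M : ℝ} {φ₁ φ₂ : ℝ → ℂ}
    (hm : AEStronglyMeasurable (fun p : ℝ × ℝ => K p.1 p.2)
      ((intervalMeasure a).prod (intervalMeasure a)))
    (hM : ∀ t ∈ Ioo (-a) a, ∀ u ∈ Ioo (-a) a, ‖K t u‖ ≤ M)
    (h₁ : Integrable φ₁ (intervalMeasure a)) (h₂ : Integrable φ₂ (intervalMeasure a)) :
    KernelFormConverges K a φ₁ φ₂ := by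
  have hc : Integrable (fun t => conj (φ₂ t)) (intervalMeasure a) :=
    (LinearIsometryEquiv.integrable_comp_iff Complex.conjLIE).2 h₂
  have h := (hc.mul_prod h₁).bdd_mul (c := M) hm (by
    rw [Measure.prod_restrict]
    filter_upwards [ae_restrict_mem (measurableSet_Ioo.prod measurableSet_Ioo)] with p hp
    exact hM _ hp.1 _ hp.2)
  refine h.congr (Filter.Eventually.of_forall fun p => ?_)
  simp only
  ring

theorem exists_norm_le_of_continuous {K : ℝ → ℝ → ℂ} (hK : Continuous fun p : ℝ × ℝ => K p.1 p.2)
    (a : ℝ) : ∃ M, ∀ t ∈ Ioo (-a) a, ∀ u ∈ Ioo (-a) a, ‖K t u‖ ≤ M := by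
  obtain ⟨M, hM⟩ := ((isCompact_Icc (a := -a) (b := a)).prod
    (isCompact_Icc (a := -a) (b := a))).exists_bound_of_continuousOn hK.continuousOn
  exact ⟨M, fun t ht u hu => hM (t, u) ⟨Ioo_subset_Icc_self ht, Ioo_subset_Icc_self hu⟩⟩

theorem kernelFormConverges_of_continuous {K : ℝ → ℝ → ℂ}
    (hK : Continuous fun p : ℝ × ℝ => K p.1 p.2) {a : ℝ} {φ₁ φ₂ : ℝ → ℂ}
    (h₁ : Integrable φ₁ (intervalMeasure a)) (h₂ : Integrable φ₂ (intervalMeasure a)) :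
    KernelFormConverges K a φ₁ φ₂ :=
  let ⟨_, hM⟩ := exists_norm_le_of_continuous hK a
  kernelFormConverges_of_bounded hK.aestronglyMeasurable hM h₁ h₂

theorem KernelFormConverges.kernelForm_eq {K : ℝ → ℝ → ℂ} {a : ℝ} {φ₁ φ₂ : ℝ → ℂ}
    (h : KernelFormConverges K a φ₁ φ₂) :
    kernelForm K a φ₁ φ₂ = ∫ p : ℝ × ℝ, K p.1 p.2 * φ₁ p.2 * conj (φ₂ p.1)
      ∂((intervalMeasure a).prod (intervalMeasure a)) :=
  (integral_prod _ h).symm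

/-- Replacing the arguments of the kernel by a simple function turns the double integral into a
finite quadratic form. -/
theorem PosDefKernel.integral_simpleFunc_nonneg {S : Set ℝ} {K : ℝ → ℝ → ℂ}
    (hK : PosDefKernel S K) (τ : SimpleFunc ℝ ℝ) (hτ : ∀ x, τ x ∈ S) {μ : Measure ℝ} [SFinite μ]
    {φ : ℝ → ℂ} (hφ : Integrable φ μ) :
    0 ≤ ∫ p : ℝ × ℝ, K (τ p.1) (τ p.2) * φ p.2 * conj (φ p.1) ∂(μ.prod μ) := by
  classical
  set f : ℝ → ℝ → ℂ := fun x => (τ ⁻¹' {x}).indicator φ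
  have hf : ∀ x, Integrable (f x) μ := fun x => hφ.indicator (τ.measurableSet_fiber x)
  have hfc : ∀ x, Integrable (fun t => conj (f x t)) μ := fun x =>
    (LinearIsometryEquiv.integrable_comp_iff Complex.conjLIE).2 (hf x)
  have hsum : ∀ p : ℝ × ℝ, K (τ p.1) (τ p.2) * φ p.2 * conj (φ p.1)
      = ∑ x : τ.range, ∑ y : τ.range, K x y * (conj (f x p.1) * f y p.2) := by
    intro p
    rw [Fintype.sum_eq_single (⟨τ p.1, τ.mem_range_self _⟩ : τ.range),
      Fintype.sum_eq_single (⟨τ p.2, τ.mem_range_self _⟩ : τ.range)]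
    · simp [f]
      ring
    · intro y hy
      have : τ p.2 ≠ y := fun h => hy (Subtype.ext h.symm)
      simp [f, this]
    · intro x hx
      have : τ p.1 ≠ x := fun h => hx (Subtype.ext h.symm)
      simp [f, this]
  have hi : ∀ x y : ℝ, Integrable (fun p : ℝ × ℝ => K x y * (conj (f x p.1) * f y p.2))
      (μ.prod μ) := fun x y => ((hfc x).mul_prod (hf y)).const_mul _
  simp only [hsum]
  rw [integral_finsetSum _ fun (x : τ.range) _ => integrable_finsetSum _ fun (y : τ.range) _ =>
    hi x y]
  -- The integral form conjugates φ at the first argument of the kernel and the finite form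
  -- conjugates at the second, so the weights are conjugates of the integrals of φ over the fibres
  -- of τ.
  have := hK τ.range Subtype.val (fun x => conj (∫ t, f x t ∂μ)) (fun x => by
    obtain ⟨t, ht⟩ := SimpleFunc.mem_range.1 x.2
    exact ht ▸ hτ t)
  refine this.trans_eq (Finset.sum_congr rfl fun x _ => ?_)
  rw [integral_finsetSum _ fun (y : τ.range) _ => hi x y]
  refine Finset.sum_congr rfl fun y _ => ?_
  rw [integral_const_mul, integral_prod_mul (fun t => conj (f x t)) (f y), integral_conj,
    RingHomCompTriple.comp_apply, RingHom.id_apply, mul_assoc]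

/-- Only the arguments of the kernel are discretised, not φ. Continuity of K gives pointwise
convergence, and its boundedness on the square gives domination. -/
theorem PosDefKernel.kernelForm_nonneg {K : ℝ → ℝ → ℂ} {a : ℝ} (ha : 0 < a)
    (hc : Continuous fun p : ℝ × ℝ => K p.1 p.2) (hK : PosDefKernel (Ioo (-a) a) K) {φ : ℝ → ℂ}
    (hφ : Integrable φ (intervalMeasure a)) : 0 ≤ kernelForm K a φ φ := by
  obtain ⟨M, hM⟩ := exists_norm_le_of_continuous hc a
  have h0 : (0 : ℝ) ∈ Ioo (-a) a := ⟨by linarith, ha⟩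
  let τ : ℕ → SimpleFunc ℝ ℝ := SimpleFunc.approxOn id measurable_id (Ioo (-a) a) 0 h0
  have hτ : ∀ n x, τ n x ∈ Ioo (-a) a := SimpleFunc.approxOn_mem measurable_id h0
  have hτt : ∀ x ∈ Ioo (-a) a, Filter.Tendsto (fun n => τ n x) Filter.atTop (nhds x) :=
    fun x hx => SimpleFunc.tendsto_approxOn measurable_id h0 (subset_closure hx)
  have hm : ∀ n, KernelFormConverges (fun t u => K (τ n t) (τ n u)) a φ φ := fun n =>
    kernelFormConverges_of_bounded ((hc.measurable.comp (((τ n).measurable.comp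
      measurable_fst).prodMk ((τ n).measurable.comp measurable_snd))).aestronglyMeasurable)
      (fun t _ u _ => hM _ (hτ n t) _ (hτ n u)) hφ hφ
  have hb : KernelFormConverges (fun _ _ => (M : ℂ)) a φ φ :=
    kernelFormConverges_of_continuous (by fun_prop) hφ hφ
  rw [(kernelFormConverges_of_continuous hc hφ hφ).kernelForm_eq]
  refine ge_of_tendsto' (tendsto_integral_of_dominated_convergence _ (fun n => (hm n).1) hb.norm
    (fun n => ?_) ?_) fun n => hK.integral_simpleFunc_nonneg (τ n) (hτ n) hφ
  · refine Filter.Eventually.of_forall fun p => ?_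
    simp only [norm_mul]
    gcongr
    exact (hM _ (hτ n _) _ (hτ n _)).trans (by simpa using le_abs_self M)
  · rw [Measure.prod_restrict]
    filter_upwards [ae_restrict_mem (measurableSet_Ioo.prod measurableSet_Ioo)] with p hp
    have h2 := (hc.tendsto p).comp ((hτt _ hp.1).prodMk_nhds (hτt _ hp.2))
    exact (h2.mul_const _).mul_const _

/-! ### The Brownian kernel and strict positivity -/

/-- A kernel of the form `∫ D(t, z) D(u, z) dz` has a form that is a squared `L²`-norm. -/
theorem kernelForm_eq_integral_normSq {D : ℝ → ℝ → ℝ} {a : ℝ} {φ : ℝ → ℂ}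
    (hD : Measurable fun p : ℝ × ℝ => D p.1 p.2) (hD1 : ∀ t z, |D t z| ≤ 1)
    {K : ℝ → ℝ → ℂ} (hKc : KernelFormConverges K a φ φ)
    (hK : ∀ t ∈ Ioo (-a) a, ∀ u ∈ Ioo (-a) a,
      K t u = ((∫ z, D t z * D u z ∂(intervalMeasure a) : ℝ) : ℂ))
    (hφ : Integrable φ (intervalMeasure a)) :
    kernelForm K a φ φ = ((∫ z, Complex.normSq (∫ t, D t z * φ t ∂(intervalMeasure a))
      ∂(intervalMeasure a) : ℝ) : ℂ) := by
  set μ := intervalMeasure a with hμ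
  have hφc : Integrable (fun t => conj (φ t)) μ :=
    (LinearIsometryEquiv.integrable_comp_iff Complex.conjLIE).2 hφ
  have hint : Integrable (fun q : (ℝ × ℝ) × ℝ => (((D q.1.1 q.2 * D q.1.2 q.2 : ℝ) : ℂ)) *
      (conj (φ q.1.1) * φ q.1.2)) ((μ.prod μ).prod μ) := by
    have h1 : Integrable (fun q : (ℝ × ℝ) × ℝ => conj (φ q.1.1) * φ q.1.2) ((μ.prod μ).prod μ) :=
      (hφc.mul_prod hφ).comp_fst μ
    refine h1.bdd_mul (c := 1) ?_ (Filter.Eventually.of_forall fun q => ?_)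
    · refine Measurable.aestronglyMeasurable (Complex.measurable_ofReal.comp (Measurable.mul ?_ ?_))
      · exact hD.comp ((measurable_fst.comp measurable_fst).prodMk measurable_snd)
      · exact hD.comp ((measurable_snd.comp measurable_fst).prodMk measurable_snd)
    · rw [Complex.norm_real, Real.norm_eq_abs, abs_mul]
      exact mul_le_one₀ (hD1 _ _) (abs_nonneg _) (hD1 _ _)
  have h2 : kernelForm K a φ φ = ∫ p : ℝ × ℝ, ∫ z, (((D p.1 z * D p.2 z : ℝ) : ℂ)) *
      (conj (φ p.1) * φ p.2) ∂μ ∂(μ.prod μ) := by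
    rw [hKc.kernelForm_eq]
    refine integral_congr_ae ?_
    rw [Measure.prod_restrict]
    filter_upwards [ae_restrict_mem (measurableSet_Ioo.prod measurableSet_Ioo)] with p hp
    rw [hK _ hp.1 _ hp.2, integral_mul_const, integral_complex_ofReal]
    ring
  rw [h2, integral_integral_swap hint, ← integral_complex_ofReal]
  refine integral_congr_ae (Filter.Eventually.of_forall fun z => ?_)
  simp only
  rw [← Complex.mul_conj, mul_comm, ← integral_conj,
    ← integral_prod_mul (fun t => conj ((D t z : ℂ) * φ t)) (fun t => (D t z : ℂ) * φ t)]
  refine integral_congr_ae (Filter.Eventually.of_forall fun p => ?_)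
  simp only [map_mul, Complex.conj_ofReal]
  push_cast
  ring

/-- The signed indicator function of the interval between `0` and `t`. -/
noncomputable def signedIndicator (t z : ℝ) : ℝ := (Iio t).indicator 1 z - (Iio 0).indicator 1 z

theorem measurable_signedIndicator : Measurable fun p : ℝ × ℝ => signedIndicator p.1 p.2 := by
  have h1 : Measurable fun p : ℝ × ℝ => (Iio p.1).indicator (1 : ℝ → ℝ) p.2 :=
    (measurable_const (a := (1 : ℝ))).indicator (measurableSet_lt measurable_snd measurable_fst)
  exact h1.sub ((measurable_one.indicator measurableSet_Iio).comp measurable_snd)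

theorem abs_signedIndicator_le (t z : ℝ) : |signedIndicator t z| ≤ 1 := by
  unfold signedIndicator indicator
  split_ifs <;> simp

theorem integral_signedIndicator_mul {a t u : ℝ} (ht : t ∈ Ioo (-a) a) (hu : u ∈ Ioo (-a) a) :
    ∫ z, signedIndicator t z * signedIndicator u z ∂(intervalMeasure a)
      = (|t| + |u| - |t - u|) / 2 := by
  have hm : ∀ x y : ℝ, (fun z => (Iio x).indicator (1 : ℝ → ℝ) z * (Iio y).indicator 1 z)
      = (Iio (min x y)).indicator 1 := by
    intro x y
    ext z
    rw [← Iio_inter_Iio, inter_indicator_one, Pi.mul_apply]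
  have hi : ∀ x y : ℝ, Integrable (fun z => (Iio x).indicator (1 : ℝ → ℝ) z *
      (Iio y).indicator 1 z) (intervalMeasure a) := by
    intro x y
    rw [hm]
    exact (integrable_const (1 : ℝ)).indicator measurableSet_Iio
  have hv : ∀ x y : ℝ, x ∈ Ioo (-a) a → y ∈ Ioo (-a) a →
      ∫ z, (Iio x).indicator (1 : ℝ → ℝ) z * (Iio y).indicator 1 z ∂(intervalMeasure a)
        = min x y + a := by
    intro x y hx hy
    have h1 : -a < min x y := lt_min hx.1 hy.1
    have h2 : min x y ≤ a := (min_le_left _ _).trans hx.2.le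
    rw [hm, integral_indicator_one measurableSet_Iio, measureReal_restrict_apply measurableSet_Iio,
      inter_comm, Ioo_inter_Iio, min_eq_right h2, Real.volume_real_Ioo_of_le h1.le]
    ring
  have h0 : (0 : ℝ) ∈ Ioo (-a) a := ⟨by linarith [ht.1, ht.2], by linarith [ht.1, ht.2]⟩
  have he : ∀ z, signedIndicator t z * signedIndicator u z =
      ((Iio t).indicator 1 z * (Iio u).indicator 1 z - (Iio t).indicator 1 z * (Iio 0).indicator 1 z)
      - ((Iio 0).indicator 1 z * (Iio u).indicator 1 z
        - (Iio 0).indicator 1 z * (Iio 0).indicator 1 z) := by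
    intro z
    unfold signedIndicator
    ring
  have hs : ∀ x y x' y' : ℝ, Integrable (fun z => (Iio x).indicator (1 : ℝ → ℝ) z *
      (Iio y).indicator 1 z - (Iio x').indicator 1 z * (Iio y').indicator 1 z)
      (intervalMeasure a) := fun x y x' y' => (hi x y).sub (hi x' y')
  have hmin : ∀ x y : ℝ, min x y = (x + y - |x - y|) / 2 := by
    intro x y
    rcases le_total x y with h | h
    · rw [min_eq_left h, abs_of_nonpos (by linarith)]
      ring
    · rw [min_eq_right h, abs_of_nonneg (by linarith)]
      ring
  simp only [he]
  rw [integral_sub (hs _ _ _ _) (hs _ _ _ _), integral_sub (hi _ _) (hi _ _),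
    integral_sub (hi _ _) (hi _ _), hv _ _ ht hu, hv _ _ ht h0, hv _ _ h0 hu, hv _ _ h0 h0,
    hmin, hmin, hmin, hmin]
  simp only [sub_zero, zero_sub, abs_neg, abs_zero]
  ring

/-- With P the primitive of φ from -a and m its total integral, the hypothesis says P = 0 a.e. to
the left of 0 and P = m a.e. to the right. By continuity P is constant on each side, and Lebesgue
differentiation gives φ = 0 a.e. -/
theorem ae_eq_zero_of_integral_signedIndicator {a : ℝ} {φ : ℝ → ℂ}
    (hφ : Integrable φ (intervalMeasure a))
    (h : ∀ᵐ z ∂(intervalMeasure a), ∫ t, signedIndicator t z * φ t ∂(intervalMeasure a) = 0) :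
    φ =ᵐ[intervalMeasure a] 0 := by
  set ψ : ℝ → ℂ := (Ioo (-a) a).indicator φ with hψ
  have hψi : Integrable ψ := (integrable_indicator_iff measurableSet_Ioo).2 hφ
  set P : ℝ → ℂ := fun z => ∫ t in (-a)..z, ψ t with hP
  have hPc : Continuous P := intervalIntegral.continuous_primitive
    (fun _ _ => hψi.intervalIntegrable) _
  set m : ℂ := ∫ t, φ t ∂(intervalMeasure a) with hm
  have hX : ∀ z ∈ Ioo (-a) a, ∫ t, signedIndicator t z * φ t ∂(intervalMeasure a)
      = m - P z - (Iio 0).indicator 1 z * m := by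
    intro z hz
    have h1 : ∀ t, (signedIndicator t z : ℂ) * φ t =
        (φ t - (Iic z).indicator φ t) - (Iio 0).indicator 1 z * φ t := by
      intro t
      by_cases h1 : z < t <;> by_cases h2 : z < 0 <;>
        simp [signedIndicator, indicator, h1, h2, not_le.2, not_lt.1]
    have h2 : P z = ∫ t, (Iic z).indicator φ t ∂(intervalMeasure a) := by
      rw [integral_indicator measurableSet_Iic, Measure.restrict_restrict measurableSet_Iic, hP]
      simp only
      rw [intervalIntegral.integral_of_le hz.1.le, hψ, integral_indicator measurableSet_Ioo,
        Measure.restrict_restrict measurableSet_Ioo]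
      congr 2
      ext t
      simp only [mem_inter_iff, mem_Ioo, mem_Ioc, mem_Iic]
      have := hz.2
      tauto
    simp only [h1]
    have h3 : Integrable (fun t => φ t - (Iic z).indicator φ t) (intervalMeasure a) :=
      hφ.sub (hφ.indicator measurableSet_Iic)
    rw [integral_sub h3 (hφ.const_mul _),
      integral_sub hφ (hφ.indicator measurableSet_Iic), integral_const_mul, h2]
  have hloc : ∀ U : Set ℝ, IsOpen U → U ⊆ Ioo (-a) a → ∀ c : ℂ,
      (∀ z ∈ U, m - (Iio 0).indicator 1 z * m = c) → EqOn P (fun _ => c) U := by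
    intro U hU hUa c hc
    refine Measure.eqOn_open_of_ae_eq (μ := volume) ?_ hU hPc.continuousOn continuousOn_const
    filter_upwards [ae_restrict_of_ae_restrict_of_subset hUa h, ae_restrict_mem hU.measurableSet]
      with z hz hzU
    rw [hX z (hUa hzU)] at hz
    rw [← hc z hzU]
    linear_combination -hz
  have hder : ∀ U : Set ℝ, IsOpen U → ∀ c : ℂ, EqOn P (fun _ => c) U → ∀ x ∈ U,
      HasDerivAt P (ψ x) x → ψ x = 0 := by
    intro U hU c hc x hx hd
    exact hd.unique ((hasDerivAt_const x c).congr_of_eventuallyEq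
      (hc.eventuallyEq_of_mem (hU.mem_nhds hx)))
  have h0 : ∀ᵐ x : ℝ, x ≠ 0 := by simp [ae_iff, measure_singleton]
  rw [Filter.EventuallyEq, ae_restrict_iff' measurableSet_Ioo]
  filter_upwards [LocallyIntegrable.ae_hasDerivAt_integral hψi.locallyIntegrable, h0] with x hx hx0 hxa
  have hψx : ψ x = φ x := indicator_of_mem hxa φ
  rw [← hψx]
  rcases lt_or_gt_of_ne hx0 with hneg | hpos
  · refine hder (Ioo (-a) 0) isOpen_Ioo 0 (hloc _ isOpen_Ioo ?_ _ ?_) x ⟨hxa.1, hneg⟩ (hx _)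
    · exact Ioo_subset_Ioo_right (by linarith [hxa.1, hxa.2])
    · intro z hz
      simp [hz.2]
  · refine hder (Ioo 0 a) isOpen_Ioo m (hloc _ isOpen_Ioo ?_ _ ?_) x ⟨hpos, hxa.2⟩ (hx _)
    · exact Ioo_subset_Ioo_left (by linarith [hxa.1, hxa.2])
    · intro z hz
      simp [hz.1.le]

theorem screwKernel_neg_abs (t u : ℝ) :
    screwKernel (fun t => ((-|t| : ℝ) : ℂ)) t u = ((|t| + |u| - |t - u| : ℝ) : ℂ) := by
  simp only [screwKernel, abs_neg, abs_zero]
  push_cast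
  ring

/-- The kernel of Brownian motion is strictly positive definite on `L¹(-a, a)`. -/
theorem kernelForm_neg_abs_pos {a : ℝ} {φ : ℝ → ℂ} (hφ : Integrable φ (intervalMeasure a))
    (h0 : ¬ φ =ᵐ[intervalMeasure a] 0) :
    0 < kernelForm (screwKernel fun t => ((-|t| : ℝ) : ℂ)) a φ φ := by
  set X : ℝ → ℂ := fun z => ∫ t, signedIndicator t z * φ t ∂(intervalMeasure a) with hX
  have hconv : ∀ c : ℂ, KernelFormConverges
      (fun t u => c * screwKernel (fun t => ((-|t| : ℝ) : ℂ)) t u) a φ φ := fun c =>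
    kernelFormConverges_of_continuous (by simp only [screwKernel_neg_abs]; fun_prop) hφ hφ
  have hform := kernelForm_eq_integral_normSq measurable_signedIndicator abs_signedIndicator_le
    (hconv (1 / 2)) (fun t ht u hu => by
      rw [integral_signedIndicator_mul ht hu, screwKernel_neg_abs]
      push_cast
      ring) hφ
  have hhalf : kernelForm (screwKernel fun t => ((-|t| : ℝ) : ℂ)) a φ φ = 2 * kernelForm
      (fun t u => (1 / 2 : ℂ) * screwKernel (fun t => ((-|t| : ℝ) : ℂ)) t u) a φ φ := by
    simp only [kernelForm, mul_assoc, integral_const_mul]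
    ring
  have hXm : AEStronglyMeasurable X (intervalMeasure a) := by
    have : AEStronglyMeasurable (fun p : ℝ × ℝ => (signedIndicator p.2 p.1 : ℂ) * φ p.2)
        ((intervalMeasure a).prod (intervalMeasure a)) :=
      (Complex.measurable_ofReal.comp (measurable_signedIndicator.comp
        measurable_swap)).aestronglyMeasurable.mul hφ.1.comp_snd
    exact this.integral_prod_right'
  have hXb : ∀ z, ‖X z‖ ≤ ∫ t, ‖φ t‖ ∂(intervalMeasure a) := fun z =>
    norm_integral_le_of_norm_le hφ.norm (Filter.Eventually.of_forall fun t => by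
      rw [norm_mul, Complex.norm_real]
      exact mul_le_of_le_one_left (norm_nonneg _) (abs_signedIndicator_le t z))
  have hXi : Integrable (fun z => Complex.normSq (X z)) (intervalMeasure a) := by
    refine Integrable.of_bound (Complex.continuous_normSq.comp_aestronglyMeasurable hXm)
      ((∫ t, ‖φ t‖ ∂(intervalMeasure a)) ^ 2) (Filter.Eventually.of_forall fun z => ?_)
    rw [Complex.normSq_eq_norm_sq, norm_pow, norm_norm]
    gcongr
    exact hXb z
  have hnn : 0 ≤ ∫ z, Complex.normSq (X z) ∂(intervalMeasure a) :=
    integral_nonneg fun z => Complex.normSq_nonneg _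
  have hne : ∫ z, Complex.normSq (X z) ∂(intervalMeasure a) ≠ 0 := by
    intro he
    rw [integral_eq_zero_iff_of_nonneg (fun z => Complex.normSq_nonneg _) hXi] at he
    exact h0 (ae_eq_zero_of_integral_signedIndicator hφ
      (he.mono fun z hz => Complex.normSq_eq_zero.1 hz))
  rw [hhalf, hform]
  have := lt_of_le_of_ne hnn hne.symm
  exact mul_pos two_pos (by exact_mod_cast this)

/-! ### The Lerch series and its truncations -/

/-- The `n`-th term `(n + 1/4)^(-2) e^(-2(n + 1/4)t)` of `e^(-t/2) Φ(e^(-2t), 2, 1/4)`. -/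
noncomputable def lerchTerm (n : ℕ) (t : ℝ) : ℝ :=
  (((n : ℝ) + 1 / 4) ^ 2)⁻¹ * Real.exp (-2 * ((n : ℝ) + 1 / 4) * t)

theorem norm_lerchTerm_le (n : ℕ) {t : ℝ} (ht : 0 ≤ t) :
    ‖lerchTerm n t‖ ≤ (((n : ℝ) + 1 / 4) ^ 2)⁻¹ := by
  unfold lerchTerm
  rw [Real.norm_of_nonneg (by positivity)]
  refine mul_le_of_le_one_right (by positivity) (Real.exp_le_one_iff.2 ?_)
  have : 0 ≤ ((n : ℝ) + 1 / 4) * t := by positivity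
  linarith

theorem summable_inv_add_quarter_sq : Summable fun n : ℕ => (((n : ℝ) + 1 / 4) ^ 2)⁻¹ := by
  have h := (Real.summable_one_div_nat_add_rpow (1 / 4) 2).2 one_lt_two
  refine h.congr fun n => ?_
  rw [abs_of_nonneg (by positivity), Real.rpow_two, one_div]

theorem summable_lerchTerm {t : ℝ} (ht : 0 ≤ t) : Summable fun n => lerchTerm n t :=
  Summable.of_norm_bounded summable_inv_add_quarter_sq fun n => norm_lerchTerm_le n ht

theorem continuous_tsum_lerchTerm : Continuous fun t : ℝ => ∑' n, lerchTerm n |t| := by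
  refine continuous_tsum (fun n => ?_) summable_inv_add_quarter_sq fun n t =>
    norm_lerchTerm_le n (abs_nonneg t)
  unfold lerchTerm
  fun_prop

theorem exp_mul_hurwitzLerch (t : ℝ) :
    Real.exp (-t / 2) * hurwitzLerch (Real.exp (-2 * t)) 2 (1 / 4) = ∑' n, lerchTerm n t := by
  rw [hurwitzLerch, ← tsum_mul_left]
  refine tsum_congr fun n => ?_
  rw [lerchTerm, Real.rpow_neg (by positivity), Real.rpow_two, ← Real.exp_nat_mul, mul_left_comm,
    ← Real.exp_add]
  ring_nf

/-- A smooth approximation on the right half-line of functions like the screw function. -/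
noncomputable def screwApprox (c q : ℝ) (N : ℕ) (t : ℝ) : ℝ :=
  c + 1 / 4 * ∑ n ∈ Finset.range N, lerchTerm n t + q * t
    - 4 * (Real.exp (1 / 2 * t) + Real.exp (-1 / 2 * t))

/-- The derivative of `screwApprox`. -/
noncomputable def screwApproxDeriv (q : ℝ) (N : ℕ) (t : ℝ) : ℝ :=
  q - 1 / 2 * ∑ n ∈ Finset.range N, ((n : ℝ) + 1 / 4)⁻¹ * Real.exp (-2 * ((n : ℝ) + 1 / 4) * t)
    - 2 * (Real.exp (1 / 2 * t) - Real.exp (-1 / 2 * t))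

/-- The second derivative of `screwApprox`. -/
noncomputable def screwApproxDeriv2 (N : ℕ) (t : ℝ) : ℝ :=
  ∑ n ∈ Finset.range N, Real.exp (-2 * ((n : ℝ) + 1 / 4) * t)
    - (Real.exp (1 / 2 * t) + Real.exp (-1 / 2 * t))

theorem hasDerivAt_exp_const_mul (c t : ℝ) :
    HasDerivAt (fun t => Real.exp (c * t)) (c * Real.exp (c * t)) t := by
  simpa [mul_comm] using ((hasDerivAt_id t).const_mul c).exp

theorem hasDerivAt_screwApprox (c q : ℝ) (N : ℕ) (t : ℝ) :
    HasDerivAt (screwApprox c q N) (screwApproxDeriv q N t) t := by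
  have h1 : HasDerivAt (fun t => ∑ n ∈ Finset.range N, lerchTerm n t)
      (∑ n ∈ Finset.range N, (((n : ℝ) + 1 / 4) ^ 2)⁻¹ * (-2 * ((n : ℝ) + 1 / 4) *
        Real.exp (-2 * ((n : ℝ) + 1 / 4) * t))) t :=
    HasDerivAt.fun_sum fun n _ => (hasDerivAt_exp_const_mul _ t).const_mul _
  have h2 := (((h1.const_mul (1 / 4)).const_add c).add ((hasDerivAt_id t).const_mul q)).sub
    (((hasDerivAt_exp_const_mul (1 / 2) t).add (hasDerivAt_exp_const_mul (-1 / 2) t)).const_mul 4)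
  refine h2.congr_deriv ?_
  have h3 : ∑ n ∈ Finset.range N, (((n : ℝ) + 1 / 4) ^ 2)⁻¹ * (-2 * ((n : ℝ) + 1 / 4) *
        Real.exp (-2 * ((n : ℝ) + 1 / 4) * t)) = -2 * ∑ n ∈ Finset.range N,
        ((n : ℝ) + 1 / 4)⁻¹ * Real.exp (-2 * ((n : ℝ) + 1 / 4) * t) := by
    rw [Finset.mul_sum]
    refine Finset.sum_congr rfl fun n _ => ?_
    have : (n : ℝ) + 1 / 4 ≠ 0 := by positivity
    field_simp
  rw [h3, screwApproxDeriv]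
  ring

theorem hasDerivAt_screwApproxDeriv (q : ℝ) (N : ℕ) (t : ℝ) :
    HasDerivAt (screwApproxDeriv q N) (screwApproxDeriv2 N t) t := by
  have h1 : HasDerivAt (fun t => ∑ n ∈ Finset.range N, ((n : ℝ) + 1 / 4)⁻¹ *
      Real.exp (-2 * ((n : ℝ) + 1 / 4) * t))
      (∑ n ∈ Finset.range N, ((n : ℝ) + 1 / 4)⁻¹ * (-2 * ((n : ℝ) + 1 / 4) *
        Real.exp (-2 * ((n : ℝ) + 1 / 4) * t))) t :=
    HasDerivAt.fun_sum fun n _ => (hasDerivAt_exp_const_mul _ t).const_mul _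
  have h2 := ((h1.const_mul (1 / 2)).const_sub q).sub
    (((hasDerivAt_exp_const_mul (1 / 2) t).sub (hasDerivAt_exp_const_mul (-1 / 2) t)).const_mul 2)
  refine h2.congr_deriv ?_
  have h3 : ∑ n ∈ Finset.range N, ((n : ℝ) + 1 / 4)⁻¹ * (-2 * ((n : ℝ) + 1 / 4) *
        Real.exp (-2 * ((n : ℝ) + 1 / 4) * t)) = -2 * ∑ n ∈ Finset.range N,
        Real.exp (-2 * ((n : ℝ) + 1 / 4) * t) := by
    rw [Finset.mul_sum]
    refine Finset.sum_congr rfl fun n _ => ?_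
    have : (n : ℝ) + 1 / 4 ≠ 0 := by positivity
    field_simp
  rw [h3, screwApproxDeriv2]
  ring

theorem continuous_screwApproxDeriv2 (N : ℕ) : Continuous (screwApproxDeriv2 N) := by
  unfold screwApproxDeriv2
  fun_prop

/-- Together with `monotone_screwApproxDeriv2`, this carries the sign conditions from one truncation
to all longer ones on the same interval, so that its length does not shrink in the limit. -/
theorem antitone_screwApproxDeriv (q t : ℝ) : Antitone fun N => screwApproxDeriv q N t := by
  refine antitone_nat_of_succ_le fun N => ?_
  simp only [screwApproxDeriv, Finset.sum_range_succ]
  have : 0 ≤ ((N : ℝ) + 1 / 4)⁻¹ * Real.exp (-2 * ((N : ℝ) + 1 / 4) * t) := by positivity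
  linarith

theorem monotone_screwApproxDeriv2 (t : ℝ) : Monotone fun N => screwApproxDeriv2 N t := by
  refine monotone_nat_of_le_succ fun N => ?_
  simp only [screwApproxDeriv2, Finset.sum_range_succ]
  have := Real.exp_nonneg (-2 * ((N : ℝ) + 1 / 4) * t)
  linarith

theorem exists_screwApproxDeriv_zero_neg (q : ℝ) :
    ∃ N, screwApproxDeriv q N 0 < 0 ∧ 0 < screwApproxDeriv2 N 0 := by
  -- At 0 the first derivative is q - ½ ∑ 1/(n + 1/4), which the harmonic series drives below zero;
  -- the second is N - 2.
  obtain ⟨N, hN, hN3⟩ := ((Real.tendsto_sum_range_one_div_nat_succ_atTop.eventually_gt_atTop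
    (2 * q)).and (Filter.eventually_ge_atTop 3)).exists
  refine ⟨N, ?_, ?_⟩
  · have : ∑ n ∈ Finset.range N, 1 / ((n : ℝ) + 1) ≤ ∑ n ∈ Finset.range N, ((n : ℝ) + 1 / 4)⁻¹ := by
      refine Finset.sum_le_sum fun n _ => ?_
      rw [one_div]
      exact inv_anti₀ (by positivity) (by linarith)
    simp only [screwApproxDeriv, mul_zero, Real.exp_zero, mul_one]
    linarith
  · have : (3 : ℝ) ≤ N := by exact_mod_cast hN3
    simp only [screwApproxDeriv2, mul_zero, Real.exp_zero, Finset.sum_const, Finset.card_range,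
      nsmul_eq_mul, mul_one]
    linarith

/-- However large the slope `q`, the singularity of the Lerch series at `0` makes the kernel
positive definite near `0`. -/
theorem exists_posDefKernel_lerch (c q : ℝ) : ∃ δ > 0, ∀ a, 2 * a ≤ δ →
    PosDefKernel (Ioo (-a) a) (screwKernel fun t => ((c + 1 / 4 * ∑' n, lerchTerm n |t| + q * |t|
      - 4 * (Real.exp (1 / 2 * |t|) + Real.exp (-1 / 2 * |t|)) : ℝ) : ℂ)) := by
  obtain ⟨N, h1, h2⟩ := exists_screwApproxDeriv_zero_neg q
  have e1 := (hasDerivAt_screwApproxDeriv q N 0).continuousAt.eventually_lt_const h1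
  have e2 := (continuous_screwApproxDeriv2 N).continuousAt.eventually_const_lt h2
  obtain ⟨r, hr, hball⟩ := Metric.eventually_nhds_iff.1 (e1.and e2)
  have hsmall : ∀ t ∈ Icc 0 (r / 2), screwApproxDeriv q N t < 0 ∧ 0 < screwApproxDeriv2 N t := by
    intro t ht
    refine hball ?_
    rw [Real.dist_0_eq_abs, abs_of_nonneg ht.1]
    linarith [ht.2]
  refine ⟨r / 2, by positivity, fun a ha => ?_⟩
  -- The criterion needs a twice differentiable function up to 0, which the full series is not; it
  -- is applied to the truncations.
  refine PosDefKernel.of_tendsto (F := fun M => screwKernel fun t => (screwApprox c q M |t| : ℂ))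
    ?_ fun x y => ?_
  · filter_upwards [Filter.eventually_ge_atTop N] with M hM
    exact posDefKernel_screwKernel_of_convex (hasDerivAt_screwApprox c q M)
      (hasDerivAt_screwApproxDeriv q M) (continuous_screwApproxDeriv2 M) ha (by positivity)
      ((antitone_screwApproxDeriv q _ hM).trans (hsmall _ (right_mem_Icc.2 (by positivity))).1.le)
      fun t ht => (hsmall t ht).2.le.trans (monotone_screwApproxDeriv2 t hM)
  · have key : ∀ t : ℝ, Filter.Tendsto (fun M => ((screwApprox c q M |t| : ℝ) : ℂ)) Filter.atTop
        (nhds ((c + 1 / 4 * ∑' n, lerchTerm n |t| + q * |t|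
          - 4 * (Real.exp (1 / 2 * |t|) + Real.exp (-1 / 2 * |t|)) : ℝ) : ℂ)) := by
      intro t
      refine (Complex.continuous_ofReal.tendsto _).comp ?_
      exact ((((summable_lerchTerm (abs_nonneg t)).hasSum.tendsto_sum_nat.const_mul _).const_add
        c).add_const _).sub_const _
    exact (((key _).sub (key _)).sub (key _)).add (key _)

/-! ### The screw function near the origin -/

/-- A continuous function that coincides with the screw function `zetaScrew` near `0`. -/
noncomputable def zetaScrewNear (t : ℝ) : ℂ :=
  ((8 - 1 / 4 * (Real.pi ^ 2 + 8 * catalanConst) + 1 / 4 * ∑' n, lerchTerm n |t|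
    + -(1 / 2 * (logDeriv Real.Gamma (1 / 4) - Real.log Real.pi)) * |t|
    - 4 * (Real.exp (1 / 2 * |t|) + Real.exp (-1 / 2 * |t|)) : ℝ) : ℂ)

theorem continuous_zetaScrewNear : Continuous zetaScrewNear := by
  unfold zetaScrewNear
  have := continuous_tsum_lerchTerm
  fun_prop

theorem zetaScrew_eq {t : ℝ} (ht : |t| < Real.log 2) : zetaScrew t = zetaScrewNear t := by
  have h1 : ⌊Real.exp |t|⌋₊ = 1 := by
    rw [Nat.floor_eq_iff (Real.exp_nonneg _)]
    have := Real.exp_lt_exp.2 ht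
    rw [Real.exp_log two_pos] at this
    exact ⟨by simp, by norm_num; exact this⟩
  rw [zetaScrew, zetaScrewNear, Psi, psiFormula, h1, exp_mul_hurwitzLerch]
  simp only [Finset.Icc_self, Finset.sum_singleton, ArithmeticFunction.vonMangoldt_apply_one,
    zero_div, zero_mul]
  congr 1
  rw [show |t| / 2 = 1 / 2 * |t| by ring, show -|t| / 2 = -1 / 2 * |t| by ring]
  ring

theorem screwKernel_zetaScrew_eq {a : ℝ} (ha : 2 * a ≤ Real.log 2) :
    ∀ t ∈ Ioo (-a) a, ∀ u ∈ Ioo (-a) a,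
      screwKernel zetaScrew t u = screwKernel zetaScrewNear t u := by
  rintro t ⟨ht1, ht2⟩ u ⟨hu1, hu2⟩
  unfold screwKernel
  rw [zetaScrew_eq (t := t - u) (abs_lt.2 ⟨by linarith, by linarith⟩),
    zetaScrew_eq (t := t) (abs_lt.2 ⟨by linarith, by linarith⟩),
    zetaScrew_eq (t := -u) (abs_lt.2 ⟨by linarith, by linarith⟩),
    zetaScrew_eq (t := 0) (abs_lt.2 ⟨by linarith, by linarith⟩)]

theorem screwKernel_zetaScrewNear (t u : ℝ) :
    screwKernel zetaScrewNear t u = screwKernel (fun t => zetaScrewNear t + |t|) t u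
      + screwKernel (fun t => ((-|t| : ℝ) : ℂ)) t u := by
  simp only [screwKernel]
  push_cast
  ring

theorem exists_posDefKernel_zetaScrewNear_add_abs : ∃ δ > 0, ∀ a, 2 * a ≤ δ →
    PosDefKernel (Ioo (-a) a) (screwKernel fun t => zetaScrewNear t + |t|) := by
  -- The added |t| only raises the slope q by 1.
  obtain ⟨δ, hδ, h⟩ := exists_posDefKernel_lerch (8 - 1 / 4 * (Real.pi ^ 2 + 8 * catalanConst))
    (1 - 1 / 2 * (logDeriv Real.Gamma (1 / 4) - Real.log Real.pi))
  refine ⟨δ, hδ, fun a ha => ?_⟩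
  convert h a ha using 3 with t
  rw [zetaScrewNear]
  push_cast
  ring

theorem posDefKernel_neg_abs (a : ℝ) :
    PosDefKernel (Ioo (-a) a) (screwKernel fun t => ((-|t| : ℝ) : ℂ)) := by
  rcases le_or_gt a 0 with ha | ha
  · intro ι _ t ξ ht
    rcases isEmpty_or_nonempty ι with _ | ⟨⟨i⟩⟩
    · simp
    · linarith [(ht i).1, (ht i).2]
  · exact posDefKernel_screwKernel_of_convex (h := fun t => -t) (h' := fun _ => -1)
      (h'' := fun _ => 0) (fun t => hasDerivAt_neg t) (fun t => hasDerivAt_const t _)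
      continuous_const le_rfl (by linarith) (by norm_num) fun _ _ => le_rfl

/-! ### Splitting the form, and the theorem -/

theorem kernelForm_congr {K K' : ℝ → ℝ → ℂ} {a : ℝ}
    (h : ∀ t ∈ Ioo (-a) a, ∀ u ∈ Ioo (-a) a, K t u = K' t u) (φ₁ φ₂ : ℝ → ℂ) :
    kernelForm K a φ₁ φ₂ = kernelForm K' a φ₁ φ₂ :=
  setIntegral_congr_fun measurableSet_Ioo fun t ht =>
    setIntegral_congr_fun measurableSet_Ioo fun u hu => by simp only [h t ht u hu]

theorem KernelFormConverges.congr {K K' : ℝ → ℝ → ℂ} {a : ℝ} {φ₁ φ₂ : ℝ → ℂ}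
    (hK : KernelFormConverges K' a φ₁ φ₂)
    (h : ∀ t ∈ Ioo (-a) a, ∀ u ∈ Ioo (-a) a, K t u = K' t u) :
    KernelFormConverges K a φ₁ φ₂ := by
  refine Integrable.congr hK ?_
  rw [Measure.prod_restrict]
  filter_upwards [ae_restrict_mem (measurableSet_Ioo.prod measurableSet_Ioo)] with p hp
  rw [h _ hp.1 _ hp.2]

theorem kernelForm_add {K K' : ℝ → ℝ → ℂ} {a : ℝ} {φ₁ φ₂ : ℝ → ℂ}
    (hK : KernelFormConverges K a φ₁ φ₂) (hK' : KernelFormConverges K' a φ₁ φ₂) :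
    kernelForm (fun t u => K t u + K' t u) a φ₁ φ₂
      = kernelForm K a φ₁ φ₂ + kernelForm K' a φ₁ φ₂ := by
  have h : KernelFormConverges (fun t u => K t u + K' t u) a φ₁ φ₂ := by
    refine (Integrable.add hK hK').congr (Filter.Eventually.of_forall fun p => ?_)
    simp only [Pi.add_apply, add_mul]
  rw [h.kernelForm_eq, hK.kernelForm_eq, hK'.kernelForm_eq, ← integral_add hK hK']
  simp only [add_mul]

theorem continuous_screwKernel {g : ℝ → ℂ} (hg : Continuous g) :
    Continuous fun p : ℝ × ℝ => screwKernel g p.1 p.2 := by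
  unfold screwKernel
  fun_prop

theorem theorem4p2 :
    ∃ a₀ : ℝ, 0 < a₀ ∧ ∀ a : ℝ, 0 < a → a < a₀ →
      IsPosDefOnL2 (screwKernel zetaScrew) a ∧ zetaScrew ∈ KreinClass a := by
  obtain ⟨δ, hδ, hpos⟩ := exists_posDefKernel_zetaScrewNear_add_abs
  -- The halves appear because t - u ranges over (-2a, 2a), which must stay within both δ and log 2
  -- of the origin.
  refine ⟨min (δ / 2) (Real.log 2 / 2),
    lt_min (by positivity) (half_pos (Real.log_pos one_lt_two)), fun a ha ha0 => ?_⟩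
  have haδ : 2 * a ≤ δ := by linarith [ha0.trans_le (min_le_left _ _)]
  have halog : 2 * a ≤ Real.log 2 := by linarith [ha0.trans_le (min_le_right _ _)]
  have hK := hpos a haδ
  have hcongr := screwKernel_zetaScrew_eq halog
  have hint : ∀ φ : Lp ℂ 2 (intervalMeasure a), Integrable φ (intervalMeasure a) :=
    fun φ => (Lp.memLp φ).integrable one_le_two
  have hc1 : Continuous fun p : ℝ × ℝ => screwKernel (fun t => zetaScrewNear t + |t|) p.1 p.2 :=
    continuous_screwKernel (continuous_zetaScrewNear.add (by fun_prop))
  have hc2 : Continuous fun p : ℝ × ℝ => screwKernel (fun t => ((-|t| : ℝ) : ℂ)) p.1 p.2 :=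
    continuous_screwKernel (by fun_prop)
  refine ⟨⟨fun φ₁ φ₂ => ?_, fun φ hφ => ?_⟩, ?_, fun t ht => ?_, fun n t ξ ht => ?_⟩
  · exact (kernelFormConverges_of_continuous (continuous_screwKernel continuous_zetaScrewNear)
      (hint _) (hint _)).congr hcongr
  · rw [kernelForm_congr hcongr, kernelForm_congr fun t _ u _ => screwKernel_zetaScrewNear t u,
      kernelForm_add (kernelFormConverges_of_continuous hc1 (hint _) (hint _))
        (kernelFormConverges_of_continuous hc2 (hint _) (hint _))]
    exact add_pos_of_nonneg_of_pos (hK.kernelForm_nonneg ha hc1 (hint φ))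
      (kernelForm_neg_abs_pos (hint φ) fun h => hφ ((Lp.eq_zero_iff_ae_eq_zero).2 h))
  · refine continuous_zetaScrewNear.continuousOn.congr fun t ht => zetaScrew_eq ?_
    exact (abs_lt.2 ht).trans_le halog
  · simp only [zetaScrew, Psi, abs_neg, Complex.conj_ofReal]
  · exact ((hK.add (posDefKernel_neg_abs a)).congr fun x hx y hy =>
      (hcongr x hx y hy).trans (screwKernel_zetaScrewNear x y)) (Fin n) t ξ
      fun i => abs_lt.1 (ht i)
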